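/- For a number field $K$ with ring of integers $\mathcal{O}_K$, a rational prime $\ell$ and an integer $f\ge 1$, let $\Pi_{\ell^f}(K)$ be the product of all maximal ideals of $\mathcal{O}_K$ of absolute norm $\ell^f$ (the unit ideal if there are none). Call $K$ a Pólya field if $\Pi_{\ell^f}(K)$ is a principal ideal for every prime $\ell$ and every $f\ge 1$. Theorem. Let $p,q,r,s$ be prime numbers such that $p\equiv q\equiv 3 \pmod 4$ and $r\equiv s\equiv 1\pmod 4$. Suppose that the Legendre symbols satisfy $$\left(\frac{2}{s}\right)=\left(\frac{q}{r}\right)=\left(\frac{s}{r}\right)=\left(\frac{p}{r}\right)=-1,\qquad \left(\frac{q}{s}\right)=\left(\frac{p}{s}\right)=1.$$ Then the field $\mathbb{Q}(\sqrt{2p},\sqrt{2qrs})$ is a Pólya field. -/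

import Mathlib

open scoped NumberField

/-- The maximal ideals of `𝓞 K` of a given norm are finite in number. -/
theorem finite_maximalIdealsOfNorm (K : Type*) [Field K] [NumberField K] (n : ℕ) :
    {m : Ideal (𝓞 K) | m.IsMaximal ∧ Ideal.absNorm m = n}.Finite :=
  (Ideal.finite_setOfPred_absNorm_eq n).subset fun _ h => h.2

/-- The Ostrowski ideal `Π_n(K)`: the product of all maximal ideals of `𝓞 K` whose
absolute norm is `n` (used for prime powers `n = ℓ ^ f`, `f ≥ 1`). It is the unit ideal if there
is no such maximal ideal. -/
noncomputable def ostrowskiIdeal (K : Type*) [Field K] [NumberField K] (n : ℕ) : Ideal (𝓞 K) :=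
  ∏ m ∈ (finite_maximalIdealsOfNorm K n).toFinset, m

/-- `K` is a Pólya field: for every prime `ℓ` and every `f ≥ 1` the Ostrowski ideal
`Π_{ℓ ^ f}(K)` is principal. -/
def IsPolyaField (K : Type*) [Field K] [NumberField K] : Prop :=
  ∀ ℓ f : ℕ, ℓ.Prime → 1 ≤ f → (ostrowskiIdeal K (ℓ ^ f)).IsPrincipal

/-- The real field `ℚ(√a, √b)`, as a subfield of `ℝ`. -/
noncomputable abbrev adjoinTwoSqrts (a b : ℕ) : IntermediateField ℚ ℝ :=
  IntermediateField.adjoin ℚ {√(a : ℝ), √(b : ℝ)}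

theorem isIntegral_sqrt_natCast (a : ℕ) : IsIntegral ℚ (√(a : ℝ)) := by
  refine IsIntegral.of_pow (n := 2) (by norm_num) ?_
  rw [Real.sq_sqrt (Nat.cast_nonneg a)]
  simpa using isIntegral_algebraMap (R := ℚ) (A := ℝ) (x := (a : ℚ))

instance instNumberFieldAdjoinTwoSqrts (a b : ℕ) : NumberField (adjoinTwoSqrts a b) where
  to_charZero := inferInstance
  to_finiteDimensional := by
    refine IntermediateField.finiteDimensional_adjoin fun x hx => ?_
    rcases hx with rfl | rfl
    · exact isIntegral_sqrt_natCast a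
    · exact isIntegral_sqrt_natCast b

/-! Let `K` be the field. It is Galois over `ℚ`, so primes above `ℓ` share residue degree and
ramification index `e`: `Π_{ℓ^f}` is trivial or has `e`-th power `(ℓ)`. It therefore suffices that
`e ≤ 2` and that `ℓ` is a unit times a square in `K` when `e = 2` (`ostrowskiIdeal_isPrincipal`).

Inertia groups have order at most 2 because some quadratic subfield is unramified at `ℓ`; where both
generators may ramify, `√(xy)`-type reasoning uses the third subfield, `ℚ(√(pqrs))`, or `ℚ(√(rs))`
if `p = q`.

Only `2, p, q, r, s` can ramify. If `√m ∈ K`, `m = d e` and `d a² - e b² = 1`, then `(d a + b √m)²`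
is `d` times a unit. Legendre's descent (`exists_mul_sq_eq_mul_sq_add_one`) solves such an equation
with `d ≠ 1`, and residue symbols leave few choices of `d`. Up to units, `2p` makes `2` and `p`
squares, `2qrs` makes `2r` and `qs` squares, and `pqrs` makes `rs` and `pq` squares; dividing yields
all five primes. -/

namespace Nat

/-! ### Factorizations and Legendre's descent. -/

theorem Prime.eq_one_or_eq_one_of_mul_eq {p d e : ℕ} (hp : p.Prime) (h : d * e = p) :
    (d = 1 ∧ e = p) ∨ (d = p ∧ e = 1) := by
  rcases (Nat.dvd_prime hp).1 ⟨e, h.symm⟩ with rfl | rfl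
  · exact .inl ⟨rfl, by simpa using h⟩
  · exact .inr ⟨rfl, by simpa [hp.ne_zero] using h⟩

theorem exists_factors_of_mul_eq_mul {d e m n : ℕ} (hm : m ≠ 0) (hn : n ≠ 0)
    (h : d * e = m * n) :
    ∃ d₁ d₂ e₁ e₂ : ℕ, d₁ * e₁ = m ∧ d₂ * e₂ = n ∧ d = d₁ * d₂ ∧ e = e₁ * e₂ := by
  obtain ⟨d₁, d₂, ⟨e₁, rfl⟩, ⟨e₂, rfl⟩, rfl⟩ :=
    exists_dvd_and_dvd_of_dvd_mul (Dvd.intro e h)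
  refine ⟨d₁, d₂, e₁, e₂, rfl, rfl, rfl, ?_⟩
  have h0 : 0 < d₁ * d₂ := Nat.pos_of_ne_zero
    (mul_ne_zero (left_ne_zero_of_mul hm) (left_ne_zero_of_mul hn))
  refine Nat.eq_of_mul_eq_mul_left h0 ?_
  rw [h]; ring

/-- Take `d = gcd(m, A)` and `e = gcd(m, B)`; the cofactors are coprime with product `z²`, so each
is a square. -/
theorem exists_sq_of_coprime_mul_eq {m A B z : ℕ} (hm : m ≠ 0) (hAB : A.Coprime B)
    (h : A * B = m * z ^ 2) :
    ∃ d e a b : ℕ, d * e = m ∧ A = d * a ^ 2 ∧ B = e * b ^ 2 := by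
  have hde : m.gcd A * m.gcd B = m := by
    rw [← hAB.gcd_mul, Nat.gcd_eq_left (Dvd.intro _ h.symm)]
  obtain ⟨a, ha⟩ := Nat.gcd_dvd_right m A
  obtain ⟨b, hb⟩ := Nat.gcd_dvd_right m B
  have hab : a * b = z ^ 2 := by
    refine Nat.eq_of_mul_eq_mul_left (Nat.pos_of_ne_zero hm) ?_
    rw [← h]
    conv_rhs => rw [ha, hb]
    conv_lhs => rw [← hde]
    ring
  have hcop : a.Coprime b :=
    Nat.Coprime.of_dvd (Dvd.intro_left _ ha.symm) (Dvd.intro_left _ hb.symm) hAB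
  obtain ⟨a', rfl⟩ := exists_eq_pow_of_mul_eq_pow (isUnit_iff_eq_one.2 hcop) hab
  obtain ⟨b', rfl⟩ := exists_eq_pow_of_mul_eq_pow (isUnit_iff_eq_one.2 hcop.symm)
    ((mul_comm _ _).trans hab)
  exact ⟨_, _, a', b', hde, ha, hb⟩

/-- Legendre's descent: if `m ≡ 1, 2 [MOD 4]` is not a square, then `m = d * e` with `d ≠ 1`
such that `d a² - e b² = 1` is solvable. -/
theorem exists_mul_sq_eq_mul_sq_add_one {m : ℕ} (hm : m % 4 = 1 ∨ m % 4 = 2)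
    (hsq : ¬ IsSquare m) :
    ∃ d e a b : ℕ, d * e = m ∧ d ≠ 1 ∧ d * a ^ 2 = e * b ^ 2 + 1 := by
  have hm0 : m ≠ 0 := by rintro rfl; simp at hm
  have hex : ∃ y : ℕ, 0 < y ∧ ∃ x : ℕ, x ^ 2 = m * y ^ 2 + 1 := by
    obtain ⟨x, y, hxy, hy⟩ := Pell.exists_of_not_isSquare (d := (m : ℤ)) (by positivity)
      (by simpa using hsq)
    refine ⟨y.natAbs, Int.natAbs_pos.2 hy, x.natAbs, ?_⟩
    zify
    rw [sq_abs, sq_abs]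
    linarith
  classical
  obtain ⟨hy, x, hxy⟩ := Nat.find_spec hex
  have hmin := fun k => Nat.find_min (H := hex) (m := k)
  generalize Nat.find hex = y at hy hxy hmin
  -- Squares are 0 or 1 modulo 4, so `m ≡ 1, 2` forces `x` odd and `y` even; then `x² - 1` splits
  -- into coprime halves `k + 1` and `k`.
  have hpar : x % 2 = 1 ∧ y % 2 = 0 := by
    have hx4 : x ^ 2 % 4 = (m % 4 * (y ^ 2 % 4) + 1) % 4 := by
      rw [hxy]; simp [Nat.add_mod, Nat.mul_mod]
    have hsq4 (n : ℕ) : (n % 2 = 0 ∧ n ^ 2 % 4 = 0) ∨ (n % 2 = 1 ∧ n ^ 2 % 4 = 1) := by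
      have : n % 4 < 4 := Nat.mod_lt _ (by norm_num)
      rw [Nat.pow_mod]
      interval_cases h : n % 4 <;> simp <;> omega
    rcases hsq4 x with hx | hx <;> rcases hsq4 y with hy | hy <;> rcases hm with hm | hm <;>
      simp [hx.2, hy.2, hm] at hx4 <;> omega
  obtain ⟨k, rfl⟩ : ∃ k, x = 2 * k + 1 := ⟨x / 2, by omega⟩
  obtain ⟨z, rfl⟩ : ∃ z, y = 2 * z := ⟨y / 2, by omega⟩
  have hk : (k + 1) * k = m * z ^ 2 := by linarith
  obtain ⟨d, e, a, b, hde, ha, hb⟩ := exists_sq_of_coprime_mul_eq hm0 (by simp) hk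
  have hab : d * a ^ 2 = e * b ^ 2 + 1 := by rw [← ha, ← hb]
  refine ⟨d, e, a, b, hde, ?_, hab⟩
  rintro rfl
  have hem : e = m := by simpa using hde
  subst hem
  have hz : z = a * b := by
    refine Nat.pow_left_injective (n := 2) two_ne_zero ?_
    refine Nat.eq_of_mul_eq_mul_left (Nat.pos_of_ne_zero hm0) ?_
    rw [← hk, ha, hb]; ring
  subst hz
  have hb0 : 0 < b := Nat.pos_of_ne_zero (by rintro rfl; simp at hy)
  have ha0 : 0 < a := Nat.pos_of_ne_zero (by rintro rfl; simp at hy)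
  -- With `d = 1`, `(a, b)` would be a Pell solution with `b < 2ab`, against minimality.
  refine hmin b ?_ ⟨hb0, a, by linarith⟩
  nlinarith

/-- `-1` is not a square modulo `q`. This excludes `e = 1` in the descent. -/
theorem mul_sq_ne_sq_add_one_of_prime {q m a b : ℕ} (hq : q.Prime) (hq4 : q % 4 = 3)
    (hqm : q ∣ m) : m * a ^ 2 ≠ b ^ 2 + 1 := by
  intro h
  have := Fact.mk hq
  refine ZMod.mod_four_ne_three_of_sq_eq_neg_one (p := q) (y := b) ?_ hq4
  have h' := congrArg (Nat.cast : ℕ → ZMod q) h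
  push_cast at h'
  rw [(ZMod.natCast_eq_zero_iff m q).2 hqm] at h'
  linear_combination -h'

end Nat

/-! ### Residue obstructions to `d a² - e b² = 1`. -/

theorem legendreSym_eq_one_of_mul_sq_eq {r d e a b : ℕ} [Fact r.Prime]
    (h : d * a ^ 2 = e * b ^ 2 + 1) (hr : r ∣ e) : legendreSym r d = 1 := by
  have h' := congrArg (Nat.cast : ℕ → ZMod r) h
  push_cast at h'
  rw [(ZMod.natCast_eq_zero_iff e r).2 hr, zero_mul, zero_add] at h'
  have hd : (d : ZMod r) ≠ 0 := by intro h0; simp [h0] at h'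
  have ha : (a : ZMod r) ≠ 0 := by intro h0; simp [h0] at h'
  have := (legendreSym.eq_one_iff' r hd).2
  refine this ⟨(a : ZMod r)⁻¹, ?_⟩
  field_simp
  exact h'

theorem legendreSym_eq_one_of_mul_sq_eq' {r d e a b : ℕ} [Fact r.Prime] (hr4 : r % 4 = 1)
    (h : d * a ^ 2 = e * b ^ 2 + 1) (hr : r ∣ d) : legendreSym r e = 1 := by
  have h' := congrArg (Nat.cast : ℕ → ZMod r) h
  push_cast at h'
  rw [(ZMod.natCast_eq_zero_iff d r).2 hr, zero_mul] at h'
  have he : (e : ZMod r) ≠ 0 := by intro h0; simp [h0] at h'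
  have hb : (b : ZMod r) ≠ 0 := by intro h0; simp [h0] at h'
  obtain ⟨i, hi⟩ := (ZMod.exists_sq_eq_neg_one_iff (p := r)).2 (by omega)
  refine (legendreSym.eq_one_iff' r he).2 ⟨i * (b : ZMod r)⁻¹, ?_⟩
  field_simp
  linear_combination -h' + hi

/-- The two Legendre symbol conditions at a prime `r ≡ 1 [MOD 4]` imposed by
`d a² - e b² = 1`. -/
theorem legendreSym_conditions {r d e a b : ℕ} [Fact r.Prime] (hr4 : r % 4 = 1)
    (h : d * a ^ 2 = e * b ^ 2 + 1) :
    (r ∣ e → legendreSym r d = 1) ∧ (r ∣ d → legendreSym r e = 1) :=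
  ⟨legendreSym_eq_one_of_mul_sq_eq h, legendreSym_eq_one_of_mul_sq_eq' hr4 h⟩

/-- A factorization into two of a product of four primes distributes the primes. -/
theorem Nat.exists_factors_of_mul_eq_four_primes {d e w x y z : ℕ} (hw : w.Prime) (hx : x.Prime)
    (hy : y.Prime) (hz : z.Prime) (h : d * e = w * x * y * z) :
    ∃ d₁ d₂ d₃ d₄ e₁ e₂ e₃ e₄ : ℕ, d = d₁ * d₂ * d₃ * d₄ ∧ e = e₁ * e₂ * e₃ * e₄ ∧
      ((d₁ = 1 ∧ e₁ = w) ∨ (d₁ = w ∧ e₁ = 1)) ∧ ((d₂ = 1 ∧ e₂ = x) ∨ (d₂ = x ∧ e₂ = 1)) ∧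
      ((d₃ = 1 ∧ e₃ = y) ∨ (d₃ = y ∧ e₃ = 1)) ∧ ((d₄ = 1 ∧ e₄ = z) ∨ (d₄ = z ∧ e₄ = 1)) := by
  obtain ⟨d', d₄, e', e₄, k₃, h₄, rfl, rfl⟩ := Nat.exists_factors_of_mul_eq_mul
    (mul_ne_zero (mul_ne_zero hw.ne_zero hx.ne_zero) hy.ne_zero) hz.ne_zero h
  obtain ⟨d', d₃, e', e₃, k₂, h₃, rfl, rfl⟩ := Nat.exists_factors_of_mul_eq_mul
    (mul_ne_zero hw.ne_zero hx.ne_zero) hy.ne_zero k₃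
  obtain ⟨d₁, d₂, e₁, e₂, h₁, h₂, rfl, rfl⟩ :=
    Nat.exists_factors_of_mul_eq_mul hw.ne_zero hx.ne_zero k₂
  exact ⟨d₁, d₂, d₃, d₄, e₁, e₂, e₃, e₄, rfl, rfl, hw.eq_one_or_eq_one_of_mul_eq h₁,
    hx.eq_one_or_eq_one_of_mul_eq h₂, hy.eq_one_or_eq_one_of_mul_eq h₃,
    hz.eq_one_or_eq_one_of_mul_eq h₄⟩

/-- The symbol at `s` of the factor prime to `s` must be 1, leaving for it `1`, `q`, `2r` or `2qr`;
the symbols at `r` exclude `q` and `2qr`. -/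
theorem eq_or_eq_of_mul_eq_two_mul {q r s d e a b : ℕ} [hq : Fact q.Prime] [hr : Fact r.Prime]
    [hs : Fact s.Prime] (hr4 : r % 4 = 1) (hs4 : s % 4 = 1)
    (h2s : legendreSym s 2 = -1) (hqs : legendreSym s q = 1) (hrs : legendreSym s r = -1)
    (hqr : legendreSym r q = -1) (hsr : legendreSym r s = -1)
    (hde : d * e = 2 * q * r * s) (hd : d ≠ 1) (he : e ≠ 1) (h : d * a ^ 2 = e * b ^ 2 + 1) :
    d = 2 * r ∨ d = q * s := by
  have hR := legendreSym_conditions (r := r) hr4 h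
  have hS := legendreSym_conditions (r := s) hs4 h
  obtain ⟨d₁, d₂, d₃, d₄, e₁, e₂, e₃, e₄, rfl, rfl, h₁, h₂, h₃, h₄⟩ :=
    Nat.exists_factors_of_mul_eq_four_primes Nat.prime_two hq.out hr.out hs.out hde
  -- Lets `simp_all` see that `r`, third of four factors, divides the product.
  have hmid (x y z : ℕ) : y ∣ x * y * z := (dvd_mul_left y x).mul_right z
  clear h hde
  rcases h₁ with ⟨rfl, rfl⟩ | ⟨rfl, rfl⟩ <;> rcases h₂ with ⟨rfl, rfl⟩ | ⟨rfl, rfl⟩ <;>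
  rcases h₃ with ⟨rfl, rfl⟩ | ⟨rfl, rfl⟩ <;> rcases h₄ with ⟨rfl, rfl⟩ | ⟨rfl, rfl⟩ <;>
  simp_all [legendreSym.mul]

theorem eq_or_eq_of_mul_eq_mul {p q r s d e a b : ℕ} [hp : Fact p.Prime] [hq : Fact q.Prime]
    [hr : Fact r.Prime] [hs : Fact s.Prime] (hr4 : r % 4 = 1) (hs4 : s % 4 = 1)
    (hps : legendreSym s p = 1) (hqs : legendreSym s q = 1) (hrs : legendreSym s r = -1)
    (hpr : legendreSym r p = -1) (hqr : legendreSym r q = -1) (hsr : legendreSym r s = -1)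
    (hde : d * e = p * q * r * s) (hd : d ≠ 1) (he : e ≠ 1) (h : d * a ^ 2 = e * b ^ 2 + 1) :
    d = r * s ∨ d = p * q := by
  have hR := legendreSym_conditions (r := r) hr4 h
  have hS := legendreSym_conditions (r := s) hs4 h
  obtain ⟨d₁, d₂, d₃, d₄, e₁, e₂, e₃, e₄, rfl, rfl, h₁, h₂, h₃, h₄⟩ :=
    Nat.exists_factors_of_mul_eq_four_primes hp.out hq.out hr.out hs.out hde
  have hmid (x y z : ℕ) : y ∣ x * y * z := (dvd_mul_left y x).mul_right z
  clear h hde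
  rcases h₁ with ⟨rfl, rfl⟩ | ⟨rfl, rfl⟩ <;> rcases h₂ with ⟨rfl, rfl⟩ | ⟨rfl, rfl⟩ <;>
  rcases h₃ with ⟨rfl, rfl⟩ | ⟨rfl, rfl⟩ <;> rcases h₄ with ⟨rfl, rfl⟩ | ⟨rfl, rfl⟩ <;>
  simp_all [legendreSym.mul]

/-! ### Integers that are squares up to units. -/

section UnitMulSq
variable {K : Type*} [Field K] [NumberField K]

/-- `n` is the square of an element of `K`, up to a unit of `𝓞 K`. -/
def IsUnitMulSq (K : Type*) [Field K] [NumberField K] (n : ℕ) : Prop :=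
  ∃ (u : (𝓞 K)ˣ) (x : K), (n : K) = algebraMap (𝓞 K) K u * x ^ 2

theorem IsUnitMulSq.of_sq_eq {n : ℕ} {x : K} (h : x ^ 2 = n) : IsUnitMulSq K n :=
  ⟨1, x, by simp [h]⟩

theorem IsUnitMulSq.of_mul_left {m n : ℕ} (hm : m ≠ 0) (hmn : IsUnitMulSq K (m * n))
    (h : IsUnitMulSq K m) : IsUnitMulSq K n := by
  obtain ⟨u, x, hx⟩ := hmn
  obtain ⟨v, y, hy⟩ := h
  have hm' : (m : K) ≠ 0 := Nat.cast_ne_zero.2 hm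
  have hy0 : y ≠ 0 := by rintro rfl; simp [hm] at hy
  refine ⟨u * v⁻¹, x / y, ?_⟩
  have hvi : algebraMap (𝓞 K) K (v⁻¹ : (𝓞 K)ˣ) * algebraMap (𝓞 K) K v = 1 := by
    rw [← map_mul, Units.inv_mul, map_one]
  push_cast at hx
  rw [Units.val_mul, map_mul, div_pow]
  refine mul_left_cancel₀ hm' ?_
  rw [hx]
  conv_rhs => rw [hy]
  field_simp
  linear_combination (-x ^ 2) * hvi

theorem IsUnitMulSq.of_mul_right {m n : ℕ} (hn : n ≠ 0) (hmn : IsUnitMulSq K (m * n))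
    (h : IsUnitMulSq K n) : IsUnitMulSq K m :=
  .of_mul_left hn (mul_comm m n ▸ hmn) h

theorem IsUnitMulSq.of_mul_sq_eq {m d e a b : ℕ} {x : K} (hx : x ^ 2 = m)
    (hde : d * e = m) (h : d * a ^ 2 = e * b ^ 2 + 1) : IsUnitMulSq K d := by
  have hint : IsIntegral ℤ x := by
    refine .of_pow (n := 2) two_pos ?_
    simpa [hx] using isIntegral_algebraMap (R := ℤ) (A := K) (x := (m : ℤ))
  let X : 𝓞 K := ⟨x, hint⟩
  have hX : X ^ 2 = d * e := by
    apply FaithfulSMul.algebraMap_injective (𝓞 K) K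
    rw [map_pow, map_mul, map_natCast, map_natCast, ← Nat.cast_mul, hde]
    exact hx
  have h' := congrArg (Nat.cast : ℕ → 𝓞 K) h
  push_cast at h'
  -- `(d a + b x)² = d u` with `u` of relative norm one
  let u : (𝓞 K)ˣ := ⟨d * a ^ 2 + e * b ^ 2 - 2 * a * b * X, d * a ^ 2 + e * b ^ 2 + 2 * a * b * X,
    by linear_combination (-4 * (a : 𝓞 K) ^ 2 * b ^ 2) * hX
        + (d * a ^ 2 - e * b ^ 2 + 1 : 𝓞 K) * h',
    by linear_combination (-4 * (a : 𝓞 K) ^ 2 * b ^ 2) * hX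
        + (d * a ^ 2 - e * b ^ 2 + 1 : 𝓞 K) * h'⟩
  have hsq : ((d : 𝓞 K) * a + b * X) ^ 2 = d * (u⁻¹ : (𝓞 K)ˣ) := by
    change _ = (d : 𝓞 K) * (d * a ^ 2 + e * b ^ 2 + 2 * a * b * X)
    linear_combination ((b : 𝓞 K) ^ 2) * hX
  refine ⟨u, algebraMap (𝓞 K) K (d * a + b * X), ?_⟩
  rw [← map_pow, ← map_mul, hsq, mul_left_comm, Units.mul_inv, mul_one, map_natCast]

theorem IsUnitMulSq.exists_span_sq {n : ℕ} (h : IsUnitMulSq K n) :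
    ∃ α : 𝓞 K, Ideal.span {α} ^ 2 = Ideal.span {(n : 𝓞 K)} := by
  obtain ⟨u, x, hx⟩ := h
  have hx2 : x ^ 2 = algebraMap (𝓞 K) K ((u⁻¹ : (𝓞 K)ˣ) * n) := by
    rw [map_mul, map_natCast, hx, ← mul_assoc, ← map_mul, Units.inv_mul, map_one, one_mul]
  obtain ⟨α, rfl⟩ := IsIntegrallyClosed.exists_algebraMap_eq_of_isIntegral_pow (R := 𝓞 K)
    (x := x) two_pos (hx2 ▸ isIntegral_algebraMap)
  refine ⟨α, ?_⟩
  rw [← map_pow] at hx2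
  rw [Ideal.span_singleton_pow, FaithfulSMul.algebraMap_injective (𝓞 K) K hx2,
    Ideal.span_singleton_mul_left_unit (Units.isUnit _)]

end UnitMulSq

/-! ### Ostrowski ideals in Galois fields. -/

section Ostrowski
variable {K : Type*} [Field K] [NumberField K] [IsGalois ℚ K]
open Ideal

/-- In a Galois number field the nontrivial Ostrowski ideals above `ℓ` have the ideal `(ℓ)` as
their power with the ramification index as exponent. -/
theorem ostrowskiIdeal_eq_one_or_pow_eq {ℓ f : ℕ} (hℓ : ℓ.Prime) :
    ostrowskiIdeal K (ℓ ^ f) = 1 ∨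
      ostrowskiIdeal K (ℓ ^ f) ^ ramificationIdxIn (span {(ℓ : ℤ)}) (𝓞 K) =
        span {(ℓ : 𝓞 K)} := by
  set p : Ideal ℤ := span {(ℓ : ℤ)} with hp
  have hpm : p.IsMaximal := have := Fact.mk hℓ; Int.ideal_span_isMaximal_of_prime ℓ
  have hp0 : p ≠ ⊥ := by simp [hp, hℓ.ne_zero]
  have hover (P : Ideal (𝓞 K)) (hP : P ∈ p.primesOver (𝓞 K)) :
      absNorm P = ℓ ^ inertiaDegIn p (𝓞 K) := by
    obtain ⟨h1, h2⟩ := hP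
    rw [inertiaDegIn_eq_inertiaDeg p P Gal(K/ℚ)]
    exact (pow_inertiaDeg ℓ P).symm
  have hmem (P : Ideal (𝓞 K)) (hP : P.IsMaximal) (hN : absNorm P = ℓ ^ f) :
      P ∈ p.primesOver (𝓞 K) := by
    refine ⟨hP.isPrime, ⟨hpm.eq_of_le (comap_ne_top _ hP.ne_top) ?_⟩⟩
    rw [hp, span_singleton_le_iff_mem, mem_comap]
    have := absNorm_mem P
    rw [hN, Nat.cast_pow] at this
    simpa using hP.isPrime.mem_of_pow_mem _ this
  by_cases hff : f = inertiaDegIn p (𝓞 K)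
  · right
    have hset : (finite_maximalIdealsOfNorm K (ℓ ^ f)).toFinset = (p.primesOver (𝓞 K)).toFinset := by
      ext P
      simp only [Set.Finite.mem_toFinset, Set.mem_toFinset, Set.mem_ofPred_eq]
      refine ⟨fun h => hmem P h.1 h.2, fun h => ⟨?_, hff ▸ hover P h⟩⟩
      obtain ⟨h1, h2⟩ := h
      exact Ideal.IsMaximal.of_liesOver_isMaximal P p
    rw [ostrowskiIdeal, hset, ← Finset.prod_pow]
    trans p.map (algebraMap ℤ (𝓞 K))
    · rw [map_algebraMap_eq_finsetProd_pow hp0]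
      refine Finset.prod_congr rfl fun P hP => ?_
      obtain ⟨h1, h2⟩ := Set.mem_toFinset.1 hP
      rw [ramificationIdxIn_eq_ramificationIdx p P Gal(K/ℚ)]
    · simp [hp, map_span]
  · left
    refine Finset.prod_eq_one fun P hP => ?_
    obtain ⟨h1, h2⟩ := (Set.Finite.mem_toFinset _).1 hP
    exact absurd (Nat.pow_right_injective hℓ.two_le (h2.symm.trans (hover P (hmem P h1 h2)))) hff

theorem ostrowskiIdeal_isPrincipal {ℓ f : ℕ} (hℓ : ℓ.Prime)
    (h : ramificationIdxIn (span {(ℓ : ℤ)}) (𝓞 K) = 1 ∨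
      ramificationIdxIn (span {(ℓ : ℤ)}) (𝓞 K) = 2 ∧ IsUnitMulSq K ℓ) :
    (ostrowskiIdeal K (ℓ ^ f)).IsPrincipal := by
  rcases ostrowskiIdeal_eq_one_or_pow_eq (K := K) hℓ (f := f) with h1 | h1
  · rw [h1, one_eq_top]; infer_instance
  · rcases h with h | ⟨h, hsq⟩
    · rw [h, pow_one] at h1
      exact ⟨_, h1⟩
    · obtain ⟨α, hα⟩ := hsq.exists_span_sq
      rw [h, ← hα] at h1
      exact ⟨α, pow_left_injective two_ne_zero h1⟩

end Ostrowski

open Ideal in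
theorem natCast_mem_iff_of_liesOver {R : Type*} [CommRing R] {ℓ : ℕ} (P : Ideal R)
    [P.LiesOver (span {(ℓ : ℤ)})] {n : ℕ} : (n : R) ∈ P ↔ ℓ ∣ n := by
  rw [← Int.natCast_dvd_natCast, ← mem_span_singleton, mem_of_liesOver P (span {(ℓ : ℤ)})]
  simp

/-! ### Inertia groups acting on square roots. -/

section Inertia
variable {K : Type*} [Field K] [NumberField K]
open Ideal IntermediateField

theorem isGalois_of_adjoin_sqrt_eq_top {x y : K} {m n : ℕ} (hx : x ^ 2 = m) (hy : y ^ 2 = n)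
    (htop : adjoin ℚ {x, y} = ⊤) : IsGalois ℚ K := by
  have hsplit (z : K) (k : ℕ) (hz : z ^ 2 = k) :
      IsIntegral ℚ z ∧ ((minpoly ℚ z).map (algebraMap ℚ K)).Splits := by
    refine ⟨.of_finite ℚ z, ?_⟩
    have hdvd : minpoly ℚ z ∣ Polynomial.X ^ 2 - Polynomial.C (k : ℚ) :=
      minpoly.dvd ℚ z (by simp [hz])
    refine Polynomial.Splits.of_dvd ?_ ?_ (Polynomial.map_dvd (algebraMap ℚ K) hdvd)
    · have : (Polynomial.X ^ 2 - Polynomial.C (k : ℚ)).map (algebraMap ℚ K) =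
          (Polynomial.X - Polynomial.C z) * (Polynomial.X - Polynomial.C (-z)) := by
        have hC : (Polynomial.C (k : K)) = Polynomial.C z ^ 2 := by rw [← map_pow, hz]
        simp only [Polynomial.map_sub, Polynomial.map_pow, Polynomial.map_X, Polynomial.map_C,
          map_natCast (algebraMap ℚ K), map_neg, hC]
        ring
      rw [this]
      exact (Polynomial.Splits.X_sub_C _).mul (Polynomial.Splits.X_sub_C _)
    · exact (((Polynomial.monic_X_pow_sub_C _ two_ne_zero).map _).ne_zero)
  have : Normal ℚ K := normal_iff.2 fun z => ⟨.of_finite ℚ z, by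
    refine splits_of_mem_adjoin ℚ K (S := {x, y}) ?_ (htop ▸ mem_top)
    rintro w (rfl | rfl)
    exacts [hsplit _ _ hx, hsplit _ _ hy]⟩
  exact {}

theorem AlgEquiv.apply_eq_or_eq_neg_of_sq_eq {x : K} {m : ℕ} (hx : x ^ 2 = m) (σ : Gal(K/ℚ)) :
    σ x = x ∨ σ x = -x := by
  refine sq_eq_sq_iff_eq_or_eq_neg.1 ?_
  rw [← map_pow, hx, map_natCast]

theorem AlgEquiv.eq_one_of_adjoin_eq_top {x y : K} (htop : adjoin ℚ {x, y} = ⊤) {σ : Gal(K/ℚ)}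
    (hx : σ x = x) (hy : σ y = y) : σ = 1 := by
  have h : (σ : K →ₐ[ℚ] K).comp (⊤ : IntermediateField ℚ K).val =
      (⊤ : IntermediateField ℚ K).val := by
    refine algHom_ext_of_eq_adjoin ℚ htop.symm ?_
    rintro z (rfl | rfl)
    exacts [hx, hy]
  ext z
  exact DFunLike.congr_fun h ⟨z, mem_top⟩

theorem card_le_two_of_adjoin_eq_top {x y : K} {n : ℕ} (hy : y ^ 2 = n)
    (htop : adjoin ℚ {x, y} = ⊤) (H : Subgroup Gal(K/ℚ)) (hH : ∀ σ ∈ H, σ x = x) :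
    Nat.card H ≤ 2 := by
  classical
  let f : H → ({y, -y} : Finset K) := fun σ => ⟨(σ : Gal(K/ℚ)) y, by
    simpa using AlgEquiv.apply_eq_or_eq_neg_of_sq_eq hy σ.1⟩
  have hf : Function.Injective f := by
    intro σ τ h
    have h' : (σ : Gal(K/ℚ)) y = (τ : Gal(K/ℚ)) y := congrArg Subtype.val h
    have := AlgEquiv.eq_one_of_adjoin_eq_top htop (σ := (τ⁻¹ * σ : H))
      (hH _ (τ⁻¹ * σ : H).2) (by
        change (τ : Gal(K/ℚ)).symm ((σ : Gal(K/ℚ)) y) = y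
        rw [h', AlgEquiv.symm_apply_apply])
    exact (inv_mul_eq_one.1 (Subtype.ext this)).symm
  calc Nat.card H ≤ Nat.card ({y, -y} : Finset K) := Nat.card_le_card_of_injective f hf
    _ ≤ 2 := by rw [Nat.card_eq_fintype_card, Fintype.card_coe]; exact Finset.card_le_two

variable {ℓ : ℕ} (P : Ideal (𝓞 K)) [P.LiesOver (span {(ℓ : ℤ)})]

/-- If `σ√m = -√m`, inertia puts `2√m`, hence `4m`, in `P`. -/
theorem apply_eq_of_mem_inertia {x : K} {m : ℕ} (hx : x ^ 2 = m) (hℓ : ¬ ℓ ∣ 4 * m)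
    {σ : Gal(K/ℚ)} (hσ : σ ∈ P.inertia Gal(K/ℚ)) : σ x = x := by
  refine (AlgEquiv.apply_eq_or_eq_neg_of_sq_eq hx σ).resolve_right fun h => hℓ ?_
  obtain ⟨X, rfl⟩ := IsIntegrallyClosed.exists_algebraMap_eq_of_isIntegral_pow (R := 𝓞 K)
    (x := x) two_pos (hx ▸ by simpa using isIntegral_algebraMap (R := 𝓞 K) (A := K) (x := m))
  rw [← natCast_mem_iff_of_liesOver P]
  have hX : X ^ 2 = m := FaithfulSMul.algebraMap_injective (𝓞 K) K (by simpa using hx)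
  have hσX : σ • X = -X := FaithfulSMul.algebraMap_injective (𝓞 K) K (by rw [map_neg]; exact h)
  have hmem : σ • X - X ∈ P := hσ X
  convert P.mul_mem_left (-2 * X) hmem using 1
  rw [hσX]
  push_cast
  linear_combination (-4) * hX

/-- Using the integer `(1 + √m)/2` instead of `√m` removes the factor 4, so `ℓ = 2` is covered. -/
theorem apply_eq_of_mem_inertia_of_mod_four {x : K} {m : ℕ} (hx : x ^ 2 = m) (hm : m % 4 = 1)
    (hℓ : ¬ ℓ ∣ m) {σ : Gal(K/ℚ)} (hσ : σ ∈ P.inertia Gal(K/ℚ)) : σ x = x := by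
  refine (AlgEquiv.apply_eq_or_eq_neg_of_sq_eq hx σ).resolve_right fun h => hℓ ?_
  obtain ⟨k, rfl⟩ : ∃ k, m = 4 * k + 1 := ⟨m / 4, by omega⟩
  obtain ⟨Y, hY⟩ : ∃ Y : 𝓞 K, algebraMap (𝓞 K) K Y = (1 + x) / 2 := by
    refine IsIntegrallyClosed.isIntegral_iff.1
      ⟨Polynomial.X ^ 2 - Polynomial.X - Polynomial.C (k : 𝓞 K), by monicity!, ?_⟩
    simp only [Polynomial.eval₂_sub, Polynomial.eval₂_pow, Polynomial.eval₂_X,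
      map_natCast, Polynomial.eval₂_natCast]
    push_cast at hx
    linear_combination hx / 4
  have hY2 : (2 * Y - 1) ^ 2 = ((4 * k + 1 : ℕ) : 𝓞 K) :=
    FaithfulSMul.algebraMap_injective (𝓞 K) K (by
      rw [map_natCast, ← hx]
      simp only [map_pow, map_sub, map_mul, map_ofNat, map_one, hY]
      ring)
  have hσY : σ • Y = 1 - Y := FaithfulSMul.algebraMap_injective (𝓞 K) K (by
    change σ (algebraMap (𝓞 K) K Y) = _
    rw [map_sub, map_one, hY]
    simp only [map_div₀, map_add, map_one, map_ofNat, h]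
    ring)
  have hmem : σ • Y - Y ∈ P := hσ Y
  rw [← natCast_mem_iff_of_liesOver P, ← hY2]
  convert P.mul_mem_left (-(2 * Y - 1)) hmem using 1
  rw [hσY]
  ring

end Inertia

/-! ### Ramification indices as orders of inertia groups. -/

section Ramification
variable {K : Type*} [Field K] [NumberField K] [IsGalois ℚ K] {ℓ : ℕ}
open Ideal IntermediateField

theorem exists_card_inertia_eq (hℓ : ℓ.Prime) :
    ∃ P : Ideal (𝓞 K), P.LiesOver (span {(ℓ : ℤ)}) ∧
      ramificationIdxIn (span {(ℓ : ℤ)}) (𝓞 K) = Nat.card (P.inertia Gal(K/ℚ)) := by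
  have hpm : (span {(ℓ : ℤ)}).IsMaximal :=
    have := Fact.mk hℓ; Int.ideal_span_isMaximal_of_prime ℓ
  obtain ⟨P, _, hP⟩ := (inferInstance : Nonempty ((span {(ℓ : ℤ)}).primesOver (𝓞 K)))
  exact ⟨P, hP, (card_inertia_eq_ramificationIdxIn _ P).symm⟩

theorem ramificationIdxIn_eq_one_or_two_of_not_dvd {x y : K} {m n : ℕ} (hx : x ^ 2 = m)
    (hy : y ^ 2 = n) (htop : adjoin ℚ {x, y} = ⊤) (hℓ : ℓ.Prime) (hm : ¬ ℓ ∣ 4 * m) :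
    ramificationIdxIn (span {(ℓ : ℤ)}) (𝓞 K) = 1 ∨
      ramificationIdxIn (span {(ℓ : ℤ)}) (𝓞 K) = 2 := by
  obtain ⟨P, hP, he⟩ := exists_card_inertia_eq (K := K) hℓ
  have h2 := card_le_two_of_adjoin_eq_top hy htop _ fun σ hσ => apply_eq_of_mem_inertia P hx hm hσ
  have h0 : 0 < Nat.card (P.inertia Gal(K/ℚ)) := Nat.card_pos
  omega

theorem ramificationIdxIn_eq_one_or_two_of_mod_four {x y : K} {m n : ℕ} (hx : x ^ 2 = m)
    (hy : y ^ 2 = n) (htop : adjoin ℚ {x, y} = ⊤) (hℓ : ℓ.Prime) (hm4 : m % 4 = 1)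
    (hm : ¬ ℓ ∣ m) :
    ramificationIdxIn (span {(ℓ : ℤ)}) (𝓞 K) = 1 ∨
      ramificationIdxIn (span {(ℓ : ℤ)}) (𝓞 K) = 2 := by
  obtain ⟨P, hP, he⟩ := exists_card_inertia_eq (K := K) hℓ
  have h2 := card_le_two_of_adjoin_eq_top hy htop _ fun σ hσ =>
    apply_eq_of_mem_inertia_of_mod_four P hx hm4 hm hσ
  have h0 : 0 < Nat.card (P.inertia Gal(K/ℚ)) := Nat.card_pos
  omega

theorem ramificationIdxIn_eq_one_of_not_dvd {x y : K} {m n : ℕ} (hx : x ^ 2 = m)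
    (hy : y ^ 2 = n) (htop : adjoin ℚ {x, y} = ⊤) (hℓ : ℓ.Prime) (hm : ¬ ℓ ∣ 4 * m)
    (hn : ¬ ℓ ∣ 4 * n) : ramificationIdxIn (span {(ℓ : ℤ)}) (𝓞 K) = 1 := by
  obtain ⟨P, hP, he⟩ := exists_card_inertia_eq (K := K) hℓ
  rw [he, Subgroup.card_eq_one, Subgroup.eq_bot_iff_forall]
  exact fun σ hσ => AlgEquiv.eq_one_of_adjoin_eq_top htop (apply_eq_of_mem_inertia P hx hm hσ)
    (apply_eq_of_mem_inertia P hy hn hσ)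

end Ramification

theorem Nat.not_isSquare_mul_of_prime {r k : ℕ} (hr : r.Prime) (hk : ¬ r ∣ k) :
    ¬ IsSquare (r * k) := by
  rintro ⟨a, ha⟩
  have hra : r ∣ a := by simpa using hr.dvd_mul.1 (Dvd.intro k ha)
  obtain ⟨b, rfl⟩ := hra
  refine hk ⟨b * b, Nat.eq_of_mul_eq_mul_left hr.pos ?_⟩
  rw [ha]; ring

/-! ### The biquadratic field. -/

section Biquadratic
variable {K : Type*} [Field K] [NumberField K] {p q r s : ℕ}

theorem isUnitMulSq_of_sq_eq_two_mul (hp : p.Prime) (hp4 : p % 4 = 3) {x : K}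
    (hx : x ^ 2 = (2 * p : ℕ)) : IsUnitMulSq K 2 ∧ IsUnitMulSq K p := by
  have hm : IsUnitMulSq K (2 * p) := .of_sq_eq hx
  obtain ⟨d, e, a, b, hde, hd, h⟩ := Nat.exists_mul_sq_eq_mul_sq_add_one (m := 2 * p) (by omega)
    (Nat.not_isSquare_mul_of_prime Nat.prime_two (by omega))
  have hU := IsUnitMulSq.of_mul_sq_eq hx hde h
  obtain ⟨d₁, d₂, e₁, e₂, h₁, h₂, rfl, rfl⟩ :=
    Nat.exists_factors_of_mul_eq_mul two_ne_zero hp.ne_zero hde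
  rcases Nat.prime_two.eq_one_or_eq_one_of_mul_eq h₁ with ⟨rfl, rfl⟩ | ⟨rfl, rfl⟩ <;>
  rcases hp.eq_one_or_eq_one_of_mul_eq h₂ with ⟨rfl, rfl⟩ | ⟨rfl, rfl⟩
  · simp at hd
  · rw [one_mul] at hU
    exact ⟨hm.of_mul_right hp.ne_zero hU, hU⟩
  · rw [mul_one] at hU
    exact ⟨hU, hm.of_mul_left two_ne_zero hU⟩
  · simp only [mul_one, one_mul] at h
    exact absurd h (Nat.mul_sq_ne_sq_add_one_of_prime hp hp4 (dvd_mul_left _ _))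

theorem isUnitMulSq_of_sq_eq_two_mul_mul [Fact q.Prime] [hr : Fact r.Prime] [hs : Fact s.Prime]
    (hq4 : q % 4 = 3) (hr4 : r % 4 = 1) (hs4 : s % 4 = 1)
    (h2s : legendreSym s 2 = -1) (hqs : legendreSym s q = 1) (hrs : legendreSym s r = -1)
    (hqr : legendreSym r q = -1) (hsr : legendreSym r s = -1) {y : K}
    (hy : y ^ 2 = (2 * q * r * s : ℕ)) (h2 : IsUnitMulSq K 2) :
    IsUnitMulSq K r ∧ IsUnitMulSq K (q * s) := by
  have hq : q.Prime := Fact.out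
  have hm : IsUnitMulSq K (2 * q * r * s) := .of_sq_eq hy
  have hqrs : (q * r * s) % 2 = 1 := by
    have : q % 2 = 1 := by omega
    have : r % 2 = 1 := by omega
    have : s % 2 = 1 := by omega
    simp [Nat.mul_mod, *]
  have h22 : (2 * q * r * s) % 4 = 2 := by
    have : 2 * q * r * s = 2 * (q * r * s) := by ring
    omega
  obtain ⟨d, e, a, b, hde, hd, h⟩ := Nat.exists_mul_sq_eq_mul_sq_add_one (.inr h22) (by
    have := Nat.not_isSquare_mul_of_prime (r := 2) (k := q * r * s) Nat.prime_two (by omega)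
    convert this using 2; ring)
  have he : e ≠ 1 := by
    rintro rfl
    rw [one_mul] at h
    refine Nat.mul_sq_ne_sq_add_one_of_prime hq hq4 ?_ h
    rw [← mul_one d, hde]
    exact ⟨2 * r * s, by ring⟩
  have hU := IsUnitMulSq.of_mul_sq_eq hy hde h
  have hm' : IsUnitMulSq K ((2 * r) * (q * s)) := by convert hm using 1; ring
  have hne : 2 * r ≠ 0 := by simp [hr.out.ne_zero]
  have hne' : q * s ≠ 0 := by simp [hq.ne_zero, hs.out.ne_zero]
  have key : IsUnitMulSq K (2 * r) ∧ IsUnitMulSq K (q * s) := by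
    rcases eq_or_eq_of_mul_eq_two_mul hr4 hs4 h2s hqs hrs hqr hsr hde hd he h with rfl | rfl
    exacts [⟨hU, hm'.of_mul_left hne hU⟩, ⟨hm'.of_mul_right hne' hU, hU⟩]
  exact ⟨key.1.of_mul_left two_ne_zero h2, key.2⟩

theorem isUnitMulSq_of_sq_eq_mul_mul_mul [hp : Fact p.Prime] [hq : Fact q.Prime] [hr : Fact r.Prime]
    [hs : Fact s.Prime] (hp4 : p % 4 = 3) (hq4 : q % 4 = 3) (hr4 : r % 4 = 1) (hs4 : s % 4 = 1)
    (hps : legendreSym s p = 1) (hqs : legendreSym s q = 1) (hrs : legendreSym s r = -1)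
    (hpr : legendreSym r p = -1) (hqr : legendreSym r q = -1) (hsr : legendreSym r s = -1) {z : K}
    (hz : z ^ 2 = (p * q * r * s : ℕ)) : IsUnitMulSq K (r * s) ∧ IsUnitMulSq K (p * q) := by
  have hm : IsUnitMulSq K (p * q * r * s) := .of_sq_eq hz
  have hm4 : (p * q * r * s) % 4 = 1 := by simp [Nat.mul_mod, *]
  -- The symbol of `pqr` at `s` is `-1`, hence nonzero; so `pqrs` is not a square.
  have hrp : ¬ s ∣ p * q * r := by
    intro h
    have := (legendreSym.eq_zero_iff s (p * q * r : ℕ)).2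
      (by rw [Int.cast_natCast]; exact (ZMod.natCast_eq_zero_iff _ _).2 h)
    simp [legendreSym.mul, hps, hqs, hrs] at this
  obtain ⟨d, e, a, b, hde, hd, h⟩ := Nat.exists_mul_sq_eq_mul_sq_add_one (.inl hm4) (by
    rw [mul_comm]; exact Nat.not_isSquare_mul_of_prime hs.out hrp)
  have he : e ≠ 1 := by
    rintro rfl
    rw [one_mul] at h
    refine Nat.mul_sq_ne_sq_add_one_of_prime hp.out hp4 ?_ h
    rw [← mul_one d, hde]
    exact ⟨q * r * s, by ring⟩
  have hU := IsUnitMulSq.of_mul_sq_eq hz hde h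
  have hm' : IsUnitMulSq K ((r * s) * (p * q)) := by convert hm using 1; ring
  have hne : r * s ≠ 0 := by simp [hr.out.ne_zero, hs.out.ne_zero]
  have hne' : p * q ≠ 0 := by simp [hp.out.ne_zero, hq.out.ne_zero]
  rcases eq_or_eq_of_mul_eq_mul hr4 hs4 hps hqs hrs hpr hqr hsr hde hd he h with rfl | rfl
  exacts [⟨hU, hm'.of_mul_left hne hU⟩, ⟨hm'.of_mul_right hne' hU, hU⟩]

open IntermediateField in
theorem isPolyaField_of_adjoin_eq_top [hp : Fact p.Prime] [hq : Fact q.Prime] [hr : Fact r.Prime]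
    [hs : Fact s.Prime] (hp4 : p % 4 = 3) (hq4 : q % 4 = 3) (hr4 : r % 4 = 1) (hs4 : s % 4 = 1)
    (h2s : legendreSym s 2 = -1) (hqr : legendreSym r q = -1) (hsr : legendreSym r s = -1)
    (hpr : legendreSym r p = -1) (hqs : legendreSym s q = 1) (hps : legendreSym s p = 1)
    {x y : K} (hx : x ^ 2 = (2 * p : ℕ)) (hy : y ^ 2 = (2 * q * r * s : ℕ))
    (htop : adjoin ℚ {x, y} = ⊤) : IsPolyaField K := by
  have hs2 : s ≠ 2 := by rintro rfl; simp at hs4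
  have hrs : legendreSym s r = -1 := by
    rw [legendreSym.quadratic_reciprocity_one_mod_four hr4 hs2, hsr]
  have : IsGalois ℚ K := isGalois_of_adjoin_sqrt_eq_top hx hy htop
  have h2p : ((2 * p : ℕ) : K) ≠ 0 := Nat.cast_ne_zero.2 (by simp [hp.out.ne_zero])
  have hx0 : x ≠ 0 := by
    rintro rfl
    exact h2p (by rw [← hx]; simp)
  obtain ⟨hU2, hUp⟩ := isUnitMulSq_of_sq_eq_two_mul hp.out hp4 hx
  obtain ⟨hUr, hUqs⟩ :=
    isUnitMulSq_of_sq_eq_two_mul_mul hq4 hr4 hs4 h2s hqs hrs hqr hsr hy hU2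
  have hcop {a b : ℕ} (ha : a.Prime) (hb : b.Prime) (hab : a ∣ b) : a = b :=
    (Nat.prime_dvd_prime_iff_eq ha hb).1 hab
  -- the third quadratic subfield, whose discriminant is odd
  obtain ⟨z, c, m, hc, hz, hzc, hm4, hpm, hUq, hUs⟩ : ∃ (z : K) (c m : ℕ), c ≠ 0 ∧ z ^ 2 = m ∧
      z * c = x * y ∧ m % 4 = 1 ∧ (p = q → ¬ p ∣ m) ∧ IsUnitMulSq K q ∧ IsUnitMulSq K s := by
    -- If `p = q`, then `pqrs` has the square factor `p²`, which must be removed for `m` to be prime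
    -- to `p`.
    by_cases hpq : p = q
    · subst hpq
      refine ⟨x * y / (2 * p : ℕ), 2 * p, r * s, by simp [hp.out.ne_zero], ?_,
        div_mul_cancel₀ _ h2p, by simp [Nat.mul_mod, *], fun _ h => ?_, hUp,
        hUqs.of_mul_left hp.out.ne_zero hUp⟩
      · rw [div_pow, mul_pow, hx, hy, div_eq_iff (pow_ne_zero _ h2p)]
        push_cast
        ring
      · rcases hp.out.dvd_mul.1 h with h | h
        · have := hcop hp.out hr.out h; omega
        · have := hcop hp.out hs.out h; omega
    · have hz : (x * y / 2) ^ 2 = (p * q * r * s : ℕ) := by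
        rw [div_pow, mul_pow, hx, hy]
        push_cast
        ring
      obtain ⟨hUrs, hUpq⟩ :=
        isUnitMulSq_of_sq_eq_mul_mul_mul hp4 hq4 hr4 hs4 hps hqs hrs hpr hqr hsr hz
      refine ⟨_, 2, p * q * r * s, two_ne_zero, hz, ?_, by simp [Nat.mul_mod, *],
        fun h => absurd h hpq, hUpq.of_mul_left hp.out.ne_zero hUp,
        hUrs.of_mul_left hr.out.ne_zero hUr⟩
      push_cast
      ring
  have htop' : adjoin ℚ {z, x} = ⊤ := by
    rw [eq_top_iff, ← htop, adjoin_le_iff]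
    have hzmem : z ∈ adjoin ℚ {z, x} := subset_adjoin _ _ (.inl rfl)
    have hxmem : x ∈ adjoin ℚ {z, x} := subset_adjoin _ _ (.inr rfl)
    rintro w (rfl | rfl)
    · exact hxmem
    · rw [← mul_div_cancel_left₀ w hx0, ← hzc]
      exact div_mem (mul_mem hzmem (IntermediateField.natCast_mem _ c)) hxmem
  intro ℓ f hℓ _
  refine ostrowskiIdeal_isPrincipal hℓ ?_
  have hU (h : ℓ ∣ 4 * (2 * p) ∨ ℓ ∣ 4 * (2 * q * r * s)) : IsUnitMulSq K ℓ := by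
    have h4 : (4 : ℕ) = 2 * 2 := rfl
    have h' : ℓ ∣ 2 ∨ ℓ ∣ p ∨ ℓ ∣ q ∨ ℓ ∣ r ∨ ℓ ∣ s := by
      simp only [h4, hℓ.dvd_mul] at h
      tauto
    rcases h' with h' | h' | h' | h' | h'
    · rwa [hcop hℓ Nat.prime_two h']
    · rwa [hcop hℓ hp.out h']
    · rwa [hcop hℓ hq.out h']
    · rwa [hcop hℓ hr.out h']
    · rwa [hcop hℓ hs.out h']
  by_cases h1 : ℓ ∣ 4 * (2 * p)
  · refine Or.imp_right (fun h => ⟨h, hU (.inl h1)⟩) ?_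
    by_cases h2 : ℓ ∣ 4 * (2 * q * r * s)
    -- Here `ℓ` is `2` or `p = q`, and neither divides `m`.
    · refine ramificationIdxIn_eq_one_or_two_of_mod_four hz hx htop' hℓ hm4 fun hm => ?_
      have hℓ2 : ℓ ≠ 2 := by rintro rfl; omega
      have hℓ2' : ¬ ℓ ∣ 2 := fun h => hℓ2 (hcop hℓ Nat.prime_two h)
      have h4 : (4 : ℕ) = 2 * 2 := rfl
      simp only [h4, hℓ.dvd_mul, hℓ2', false_or] at h1 h2
      obtain rfl := hcop hℓ hp.out h1
      rcases h2 with (h2 | h2) | h2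
      · exact hpm (hcop hℓ hq.out h2) hm
      · have := hcop hℓ hr.out h2; omega
      · have := hcop hℓ hs.out h2; omega
    · exact ramificationIdxIn_eq_one_or_two_of_not_dvd hy hx
        (by rw [Set.pair_comm]; exact htop) hℓ h2
  · by_cases h2 : ℓ ∣ 4 * (2 * q * r * s)
    · exact Or.imp_right (fun h => ⟨h, hU (.inr h2)⟩)
        (ramificationIdxIn_eq_one_or_two_of_not_dvd hx hy htop hℓ h1)
    · exact .inl (ramificationIdxIn_eq_one_of_not_dvd hx hy htop hℓ h1 h2)

end Biquadratic

theorem IntermediateField.adjoin_pair_eq_top (F : Type*) {E : Type*} [Field F] [Field E]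
    [Algebra F E] (a b : E) :
    adjoin F {(⟨a, subset_adjoin F _ (Set.mem_insert a {b})⟩ : adjoin F {a, b}),
      ⟨b, subset_adjoin F _ (Set.mem_insert_of_mem a rfl)⟩} = ⊤ := by
  apply lift_injective
  rw [lift_adjoin, lift_top, Set.image_pair]

theorem theorem1p5 (p q r s : ℕ) [Fact p.Prime] [Fact q.Prime] [Fact r.Prime] [Fact s.Prime]
    (hp : p ≡ 3 [MOD 4]) (hq : q ≡ 3 [MOD 4]) (hr : r ≡ 1 [MOD 4]) (hs : s ≡ 1 [MOD 4])
    (h2s : legendreSym s 2 = -1) (hqr : legendreSym r q = -1) (hsr : legendreSym r s = -1)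
    (hpr : legendreSym r p = -1) (hqs : legendreSym s q = 1) (hps : legendreSym s p = 1) :
    IsPolyaField (adjoinTwoSqrts (2 * p) (2 * q * r * s)) := by
  have htop := IntermediateField.adjoin_pair_eq_top ℚ (√((2 * p : ℕ) : ℝ))
    (√((2 * q * r * s : ℕ) : ℝ))
  refine isPolyaField_of_adjoin_eq_top hp hq hr hs h2s hqr hsr hpr hqs hps
    (x := ⟨_, IntermediateField.subset_adjoin ℚ _ (Set.mem_insert _ _)⟩)
    (y := ⟨_, IntermediateField.subset_adjoin ℚ _ (Set.mem_insert_of_mem _ rfl)⟩)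
    (Subtype.ext (Real.sq_sqrt (Nat.cast_nonneg _)))
    (Subtype.ext (Real.sq_sqrt (Nat.cast_nonneg _))) ?_
  -- The two sides differ only in the `ℚ`-algebra instance, which is unique.
  convert htop <;> exact Subsingleton.elim _ _
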